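/- Let $K$ be a pathwise connected poset. A 1-simplex $b$ of $K$ from $a=\partial_1b$ to $o=\partial_0b$ is given by a support $|b|\in K$ with $a\le|b|$, $o\le|b|$; a 2-simplex $c$ consists of 1-simplices $\partial_2c:a\to e$, $\partial_0c:e\to o$, $\partial_1c:a\to o$ and a support $|c|$ lying above their supports. A path $p=b_n*\cdots*b_1$ ($n\ge1$) is a finite composition of 1-simplices, pathwise connected means that any two elements are joined by a path, and homotopy $\sim$ of paths is generated by replacing two consecutive 1-simplices $\partial_0c*\partial_2c$ by $\partial_1c$. For $a\le o$, $(oa):a\to o$ is the 1-simplex with support $o$; $\iota_o:=(oo)$. A net of C*-algebras $(\mathcal A,\jmath)_K$ assigns to every $o\in K$ a unital C*-algebra $\mathcal A_o$ and to every $a\le o$ an injective unital $*$-morphism $\jmath_{oa}:\mathcal A_a\to\mathcal A_o$ with $\jmath_{oa}\jmath_{ae}=\jmath_{oe}$ for $e\le a\le o$; it is a C*-net bundle if all $\jmath_{oa}$ are $*$-isomorphisms, and it vanishes if all fibres are $\{0\}$. A morphism of nets over $K$ is a family of ($*$-preserving, not necessarily unital) morphisms of the fibres commuting with the inclusion maps.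 The enveloping net bundle $(\overline{\mathcal A},\overline\jmath)_K$ is built as follows. For $o\in K$ take the unital $*$-algebra generated by the symbols $(p,A)$, with $p:a\to o$ a path and $A\in\mathcal A_a$, with $(p,A)^*=(p,A^*)$, subject to: $A\mapsto(p,A)$ is linear, multiplicative and unital; $(p,\jmath_{\tilde aa}(A))=(p*(\tilde aa),A)$ for $a\le\tilde a$, $p:\tilde a\to o$; $(p,A)=(q,A)$ if $p\sim q$. Inclusion maps are given by $(p,A)\mapsto((\tilde oo)*p,A)$ for $o\le\tilde o$. Put $\|W\|=\sup_\pi\|\pi_o(W)\|$, the supremum being over all morphisms $\pi$ of this net bundle of $*$-algebras into C*-net bundles over $K$. Then $\overline{\mathcal A}_o$ is the completion of the quotient by the elements of zero seminorm, with the induced inclusion maps. The canonical embedding is $\epsilon_o(A)=(\iota_o,A)$. The net is nondegenerate if its enveloping net bundle does not vanish, and injective if it is nondegenerate and every $\epsilon_o$ is injective. A representation $(\pi,U)$ of the net consists of Hilbert spaces $\mathcal H_o$, $*$-representations $\pi_o:\mathcal A_o\to\mathcal B(\mathcal H_o)$ (not necessarily unital) and unitaries $U_{oa}:\mathcal H_a\to\mathcal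 H_o$, $a\le o$, with $U_{oa}\,\pi_a(A)=\pi_o(\jmath_{oa}(A))\,U_{oa}$ for $A\in\mathcal A_a$, and $U_{oa}U_{ae}=U_{oe}$ for $e\le a\le o$. It is faithful if every $\pi_o$ is injective, and it vanishes if $\pi_o(A)=0$ for all $o$ and $A$. Theorem. Let $(\mathcal A,\jmath)_K$ be a net of C*-algebras over $K$. (i) If the net does not vanish, then it is injective if and only if it has a faithful representation. (ii) The net is nondegenerate if and only if it has a nonvanishing representation. -/

import Mathlib

universe u v w

/-! ## Singular simplices and paths of a poset -/

section Paths

variable {K : Type u} [PartialOrder K]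

/-- A singular 1-simplex `b` of the poset `K` with `∂₁ b = a` and `∂₀ b = o`: it is determined
by its faces and by its support `|b|`, which lies above both faces. -/
@[ext]
structure OneSimplex (a o : K) where
  supp : K
  le_source : a ≤ supp
  le_target : o ≤ supp

/-- The opposite 1-simplex. -/
def OneSimplex.opp {a o : K} (b : OneSimplex a o) : OneSimplex o a :=
  ⟨b.supp, b.le_target, b.le_source⟩

/-- The degenerate 1-simplex `σ₀ o`. -/
def OneSimplex.degenerate (o : K) : OneSimplex o o := ⟨o, le_rfl, le_rfl⟩

/-- The 1-simplex `(o a)` of the nerve associated with an inclusion `a ≤ o`: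
it goes from `a` to `o` and its support is `o`. -/
def OneSimplex.nerve {a o : K} (h : a ≤ o) : OneSimplex a o := ⟨o, h, le_rfl⟩

/-- A singular 2-simplex `c` of the poset `K` with vertices `a`, `e`, `o`: three 1-simplices
`∂₂ c : a → e`, `∂₀ c : e → o`, `∂₁ c : a → o` and a support `|c|` above their supports. -/
structure TwoSimplex (a e o : K) where
  face0 : OneSimplex e o
  face1 : OneSimplex a o
  face2 : OneSimplex a e
  supp : K
  le0 : face0.supp ≤ supp
  le1 : face1.supp ≤ supp
  le2 : face2.supp ≤ supp

/-- `PosetPath a o` is the type of paths `bₙ * ⋯ * b₁ : a → o` (`n ≥ 1`) in `K`;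
`PosetPath.cons b p` is `b * p`. -/
inductive PosetPath : K → K → Type u
  | single {a o : K} (b : OneSimplex a o) : PosetPath a o
  | cons {a e o : K} (b : OneSimplex e o) (p : PosetPath a e) : PosetPath a o

/-- An elementary deformation: two consecutive 1-simplices `∂₀ c * ∂₂ c` occurring anywhere in a
path are replaced by `∂₁ c`, for a 2-simplex `c`. -/
inductive PosetPath.Deformation : {a o : K} → PosetPath a o → PosetPath a o → Prop
  | single {a e o : K} (c : TwoSimplex a e o) :
      Deformation (.cons c.face0 (.single c.face2)) (.single c.face1)
  | cons {x a e o : K} (c : TwoSimplex a e o) (p : PosetPath x a) :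
      Deformation (.cons c.face0 (.cons c.face2 p)) (.cons c.face1 p)
  | left {a e o : K} (b : OneSimplex e o) {p q : PosetPath a e} :
      Deformation p q → Deformation (.cons b p) (.cons b q)

/-- Homotopy equivalence of paths: one is obtained from the other by a finite sequence
of elementary deformations and inverses of elementary deformations. -/
def PosetPath.Homotopic {a o : K} : PosetPath a o → PosetPath a o → Prop :=
  Relation.EqvGen PosetPath.Deformation

/-- The composition `q * p` of paths. -/
def PosetPath.comp {a e : K} (p : PosetPath a e) : {o : K} → PosetPath e o → PosetPath a o
  | _, .single b => .cons b p
  | _, .cons b q => .cons b (PosetPath.comp p q)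

/-- The trivial loop over `o`, i.e. the degenerate 1-simplex. -/
def PosetPath.trivial (o : K) : PosetPath o o := .single (.degenerate o)

theorem PosetPath.Homotopic.cons {a e o : K} (b : OneSimplex e o) {p q : PosetPath a e}
    (h : p.Homotopic q) : (PosetPath.cons b p).Homotopic (PosetPath.cons b q) := by
  induction h with
  | rel _ _ h => exact .rel _ _ (.left b h)
  | refl _ => exact .refl _
  | symm _ _ _ ih => exact .symm _ _ ih
  | trans _ _ _ _ _ ih1 ih2 => exact .trans _ _ _ ih1 ih2

/-- `∂₀ c * ∂₂ c * p ∼ ∂₁ c * p`. -/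
theorem PosetPath.homotopic_face {x a e o : K} (c : TwoSimplex a e o) (p : PosetPath x a) :
    (PosetPath.cons c.face0 (.cons c.face2 p)).Homotopic (.cons c.face1 p) :=
  .rel _ _ (.cons c p)

/-- `(e o) * (o a) * p ∼ (e a) * p`. -/
theorem PosetPath.homotopic_nerve {x a o e : K} (h : a ≤ o) (h' : o ≤ e) (p : PosetPath x a) :
    (PosetPath.cons (.nerve h') (.cons (.nerve h) p)).Homotopic
      (.cons (.nerve (h.trans h')) p) :=
  PosetPath.homotopic_face ⟨.nerve h', .nerve (h.trans h'), .nerve h, e, le_rfl, le_rfl, h'⟩ p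

/-- `σ₀ o * p ∼ p`. -/
theorem PosetPath.homotopic_degenerate {x o : K} (p : PosetPath x o) :
    (PosetPath.cons (.degenerate o) p).Homotopic p := by
  cases p with
  | single b => exact .rel _ _ (.single ⟨.degenerate o, b, b, b.supp, b.le_target, le_rfl, le_rfl⟩)
  | cons b p =>
    exact PosetPath.homotopic_face
      ⟨.degenerate o, b, b, b.supp, b.le_target, le_rfl, le_rfl⟩ p

/-- `b̄ * b * p ∼ p`. -/
theorem PosetPath.homotopic_opp {x a o : K} (b : OneSimplex a o) (p : PosetPath x a) :
    (PosetPath.cons b.opp (.cons b p)).Homotopic p :=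
  .trans _ _ _
    (PosetPath.homotopic_face ⟨b.opp, .degenerate a, b, b.supp, le_rfl, b.le_source, le_rfl⟩ p)
    (PosetPath.homotopic_degenerate p)

end Paths

/-- A poset is pathwise connected if any two of its elements are joined by a path. -/
def IsPathwiseConnected (K : Type u) [PartialOrder K] : Prop :=
  ∀ a o : K, Nonempty (PosetPath a o)

/-! ## Nets of C*-algebras -/

/-- A net of unital C*-algebras over the poset `K`: the fibres are unital C*-algebras and the
inclusion maps are unital faithful *-morphisms satisfying the net relations. -/
structure CStarNet (K : Type u) [PartialOrder K] where
  fibre : K → Type v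
  [cstar : ∀ o, CStarAlgebra (fibre o)]
  incl : ∀ {a o : K}, a ≤ o → fibre a →⋆ₐ[ℂ] fibre o
  incl_injective : ∀ {a o : K} (h : a ≤ o), Function.Injective (incl h)
  incl_incl : ∀ {e a o : K} (h : e ≤ a) (h' : a ≤ o) (A : fibre e),
    incl h' (incl h A) = incl (h.trans h') A

attribute [instance] CStarNet.cstar

namespace CStarNet

section Nets

variable {K : Type u} [PartialOrder K]

/-- A C*-net bundle is a net all of whose inclusion maps are *-isomorphisms. -/
def IsBundle (N : CStarNet.{u, v} K) : Prop :=
  ∀ {a o : K} (h : a ≤ o), Function.Bijective (N.incl h)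

/-- A net vanishes if all its fibres are `{0}`. -/
def Vanishes (N : CStarNet.{u, v} K) : Prop :=
  ∀ o : K, Subsingleton (N.fibre o)

/-- A morphism of nets over `K` (covering the identity of `K`): a family of *-morphisms,
not necessarily unital, compatible with the inclusion maps. -/
structure Hom (N : CStarNet.{u, v} K) (M : CStarNet.{u, w} K) where
  map : ∀ o : K, N.fibre o →⋆ₙₐ[ℂ] M.fibre o
  map_incl : ∀ {a o : K} (h : a ≤ o) (A : N.fibre a),
    map o (N.incl h A) = M.incl h (map a A)

/-- A morphism of nets over `K` is unital if all its components are unital. -/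
def Hom.IsUnital {N : CStarNet.{u, v} K} {M : CStarNet.{u, w} K} (φ : Hom N M) : Prop :=
  ∀ o : K, φ.map o 1 = 1

/-- A morphism of nets over `K` is a monomorphism if all its components are faithful. -/
def Hom.IsMono {N : CStarNet.{u, v} K} {M : CStarNet.{u, w} K} (φ : Hom N M) : Prop :=
  ∀ o : K, Function.Injective (φ.map o)

/-! ### The net bundle of *-algebras generated by a net -/

variable (N : CStarNet.{u, v} K)

/-- The generators `(p, A)` of the free algebra over `o`: `p : a → o` is a path, `A ∈ 𝒜 a`. -/
structure EnvGen (o : K) where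
  source : K
  path : PosetPath source o
  elt : N.fibre source

/-- The generator `(p, A)` as an element of the free unital algebra. -/
def freeGen {a o : K} (p : PosetPath a o) (A : N.fibre a) : FreeAlgebra ℂ (N.EnvGen o) :=
  FreeAlgebra.ι ℂ ⟨a, p, A⟩

/-- The relations imposed on the free unital algebra over `o`: the map `A ↦ (p, A)` is linear,
multiplicative and unital for every path `p`, isotony, and homotopy invariance. -/
inductive EnvRel (o : K) : FreeAlgebra ℂ (N.EnvGen o) → FreeAlgebra ℂ (N.EnvGen o) → Prop
  | mul {a : K} (p : PosetPath a o) (A B : N.fibre a) :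
      EnvRel o (N.freeGen p A * N.freeGen p B) (N.freeGen p (A * B))
  | add {a : K} (p : PosetPath a o) (A B : N.fibre a) :
      EnvRel o (N.freeGen p (A + B)) (N.freeGen p A + N.freeGen p B)
  | smul {a : K} (p : PosetPath a o) (z : ℂ) (A : N.fibre a) :
      EnvRel o (N.freeGen p (z • A)) (z • N.freeGen p A)
  | one {a : K} (p : PosetPath a o) : EnvRel o (N.freeGen p (1 : N.fibre a)) 1
  | zero {a : K} (p : PosetPath a o) : EnvRel o (N.freeGen p (0 : N.fibre a)) 0
  | isotony {a a' : K} (h : a ≤ a') (p : PosetPath a' o) (A : N.fibre a) :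
      EnvRel o (N.freeGen p (N.incl h A))
        (N.freeGen (PosetPath.comp (.single (.nerve h)) p) A)
  | homotopy {a : K} {p q : PosetPath a o} (h : p.Homotopic q) (A : N.fibre a) :
      EnvRel o (N.freeGen p A) (N.freeGen q A)

/-- The unital algebra over `o` generated by the symbols `(p, A)` with the relations above. -/
def EnvAlg (o : K) : Type (max u v) := RingQuot (N.EnvRel o)

noncomputable instance (o : K) : Ring (N.EnvAlg o) := inferInstanceAs (Ring (RingQuot _))
noncomputable instance (o : K) : Algebra ℂ (N.EnvAlg o) :=
  inferInstanceAs (Algebra ℂ (RingQuot _))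

/-- The quotient map. -/
noncomputable def envMk (o : K) : FreeAlgebra ℂ (N.EnvGen o) →ₐ[ℂ] N.EnvAlg o :=
  RingQuot.mkAlgHom ℂ (N.EnvRel o)

/-- The class of the generator `(p, A)`. -/
noncomputable def gen {a o : K} (p : PosetPath a o) (A : N.fibre a) : N.EnvAlg o :=
  N.envMk o (N.freeGen p A)

theorem envMk_rel {o : K} {x y : FreeAlgebra ℂ (N.EnvGen o)} (h : N.EnvRel o x y) :
    N.envMk o x = N.envMk o y :=
  RingQuot.mkAlgHom_rel ℂ h

theorem envMk_surjective (o : K) : Function.Surjective (N.envMk o) :=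
  RingQuot.mkAlgHom_surjective ℂ _

variable {N} in
theorem env_induction {o : K} {P : N.EnvAlg o → Prop}
    (scalar : ∀ z : ℂ, P (algebraMap ℂ _ z))
    (gen : ∀ {a : K} (p : PosetPath a o) (A : N.fibre a), P (N.gen p A))
    (mul : ∀ x y, P x → P y → P (x * y)) (add : ∀ x y, P x → P y → P (x + y))
    (x : N.EnvAlg o) : P x := by
  obtain ⟨x, rfl⟩ := N.envMk_surjective o x
  induction x using FreeAlgebra.induction with
  | grade0 r => simpa using scalar r
  | grade1 x => exact gen x.path x.elt
  | mul a b ha hb => simpa using mul _ _ ha hb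
  | add a b ha hb => simpa using add _ _ ha hb

theorem gen_mul {a o : K} (p : PosetPath a o) (A B : N.fibre a) :
    N.gen p (A * B) = N.gen p A * N.gen p B := by
  simpa [gen] using (N.envMk_rel (.mul p A B)).symm

theorem gen_add {a o : K} (p : PosetPath a o) (A B : N.fibre a) :
    N.gen p (A + B) = N.gen p A + N.gen p B := by
  simpa [gen] using N.envMk_rel (.add p A B)

theorem gen_smul {a o : K} (p : PosetPath a o) (z : ℂ) (A : N.fibre a) :
    N.gen p (z • A) = z • N.gen p A := by
  simpa [gen] using N.envMk_rel (.smul p z A)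

theorem gen_one {a o : K} (p : PosetPath a o) : N.gen p (1 : N.fibre a) = 1 := by
  simpa [gen] using N.envMk_rel (.one p)

theorem gen_zero {a o : K} (p : PosetPath a o) : N.gen p (0 : N.fibre a) = 0 := by
  simpa [gen] using N.envMk_rel (.zero p)

theorem gen_isotony {a a' o : K} (h : a ≤ a') (p : PosetPath a' o) (A : N.fibre a) :
    N.gen p (N.incl h A) = N.gen (PosetPath.comp (.single (.nerve h)) p) A :=
  N.envMk_rel (.isotony h p A)

theorem gen_homotopy {a o : K} {p q : PosetPath a o} (h : p.Homotopic q) (A : N.fibre a) :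
    N.gen p A = N.gen q A :=
  N.envMk_rel (.homotopy h A)

/-- The antilinear antimultiplicative extension of `(p, A) ↦ (p, A*)` to the free algebra: a ring
morphism into the opposite ring, on which the scalars act through complex conjugation. -/
noncomputable def freeStar (o : K) : FreeAlgebra ℂ (N.EnvGen o) →+* (N.EnvAlg o)ᵐᵒᵖ :=
  letI : Algebra ℂ (N.EnvAlg o)ᵐᵒᵖ :=
    Algebra.compHom (N.EnvAlg o)ᵐᵒᵖ (starRingEnd ℂ)
  (FreeAlgebra.lift ℂ
    (fun g : N.EnvGen o => MulOpposite.op (N.gen g.path (star g.elt)))).toRingHom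

theorem freeStar_gen {a o : K} (p : PosetPath a o) (A : N.fibre a) :
    N.freeStar o (N.freeGen p A) = MulOpposite.op (N.gen p (star A)) := by
  let : Algebra ℂ (N.EnvAlg o)ᵐᵒᵖ :=
    Algebra.compHom (N.EnvAlg o)ᵐᵒᵖ (starRingEnd ℂ)
  exact FreeAlgebra.lift_ι_apply (R := ℂ) (A := (N.EnvAlg o)ᵐᵒᵖ) _ _

theorem freeStar_scalar {o : K} (z : ℂ) :
    N.freeStar o (algebraMap ℂ _ z) =
      MulOpposite.op (algebraMap ℂ (N.EnvAlg o) (starRingEnd ℂ z)) := by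
  let : Algebra ℂ (N.EnvAlg o)ᵐᵒᵖ :=
    Algebra.compHom (N.EnvAlg o)ᵐᵒᵖ (starRingEnd ℂ)
  exact AlgHom.commutes (FreeAlgebra.lift ℂ
    (fun g : N.EnvGen o => MulOpposite.op (N.gen g.path (star g.elt)))) z

theorem freeStar_rel {o : K} ⦃x y : FreeAlgebra ℂ (N.EnvGen o)⦄ (h : N.EnvRel o x y) :
    N.freeStar o x = N.freeStar o y := by
  induction h with
  | mul p A B => simp [freeStar_gen, ← MulOpposite.op_mul, ← gen_mul]
  | add p A B => simp [freeStar_gen, gen_add]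
  | smul p z A =>
    rw [Algebra.smul_def z (N.freeGen p A), map_mul, freeStar_scalar, freeStar_gen, freeStar_gen, star_smul,
      gen_smul, ← MulOpposite.op_mul, Algebra.smul_def]
    congr 1
    exact Algebra.commutes _ _
  | one p => simp [freeStar_gen, gen_one]
  | zero p => simp [freeStar_gen, gen_zero]
  | isotony h p A => rw [freeStar_gen, freeStar_gen, ← map_star, gen_isotony]
  | homotopy h A => rw [freeStar_gen, freeStar_gen, N.gen_homotopy h]

/-- The adjoint, as a ring morphism into the opposite ring. -/
noncomputable def envStar (o : K) : N.EnvAlg o →+* (N.EnvAlg o)ᵐᵒᵖ :=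
  RingQuot.lift ⟨N.freeStar o, N.freeStar_rel⟩

theorem envStar_mk {o : K} (x : FreeAlgebra ℂ (N.EnvGen o)) :
    N.envStar o (N.envMk o x) = N.freeStar o x := by
  have : N.envMk o x = RingQuot.mkRingHom _ x := by
    rw [← RingQuot.mkAlgHom_coe ℂ]; rfl
  rw [this]
  exact RingQuot.lift_mkRingHom_apply (N.freeStar o) N.freeStar_rel x

theorem envStar_gen {a o : K} (p : PosetPath a o) (A : N.fibre a) :
    N.envStar o (N.gen p A) = MulOpposite.op (N.gen p (star A)) := by
  rw [gen, envStar_mk, freeStar_gen]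

theorem envStar_scalar {o : K} (z : ℂ) :
    N.envStar o (algebraMap ℂ _ z) =
      MulOpposite.op (algebraMap ℂ (N.EnvAlg o) (starRingEnd ℂ z)) := by
  rw [← AlgHom.commutes (N.envMk o), envStar_mk, freeStar_scalar]

noncomputable instance (o : K) : StarRing (N.EnvAlg o) where
  star x := (N.envStar o x).unop
  star_involutive x := by
    induction x using env_induction with
    | scalar z => simp [envStar_scalar]
    | gen p A => simp [envStar_gen]
    | mul x y hx hy => simp [hx, hy]
    | add x y hx hy => simp [hx, hy]
  star_mul x y := by simp
  star_add x y := by simp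

theorem star_gen {a o : K} (p : PosetPath a o) (A : N.fibre a) :
    star (N.gen p A) = N.gen p (star A) :=
  congrArg MulOpposite.unop (N.envStar_gen p A)

theorem star_scalar {o : K} (z : ℂ) :
    star (algebraMap ℂ (N.EnvAlg o) z) = algebraMap ℂ (N.EnvAlg o) (star z) :=
  congrArg MulOpposite.unop (N.envStar_scalar z)

instance (o : K) : StarModule ℂ (N.EnvAlg o) where
  star_smul z x := by
    rw [Algebra.smul_def, star_mul, star_scalar, Algebra.smul_def]
    exact (Algebra.commutes _ _).symm

/-- The extension of `(p, A) ↦ (b * p, A)` to a morphism, for a 1-simplex `b`. -/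
noncomputable def envTransport {o o' : K} (b : OneSimplex o o') :
    N.EnvAlg o →ₐ[ℂ] N.EnvAlg o' :=
  RingQuot.liftAlgHom ℂ (s := N.EnvRel o)
    ⟨FreeAlgebra.lift ℂ (fun g : N.EnvGen o => N.gen (.cons b g.path) g.elt), by
      intro x y h
      induction h with
      | mul p A B => simp [freeGen, gen_mul]
      | add p A B => simp [freeGen, gen_add]
      | smul p z A => simp [freeGen, gen_smul]
      | one p => simp [freeGen, gen_one]
      | zero p => simp [freeGen, gen_zero]
      | isotony h p A =>
        simp only [freeGen, FreeAlgebra.lift_ι_apply]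
        rw [gen_isotony]
        rfl
      | homotopy h A =>
        simp only [freeGen, FreeAlgebra.lift_ι_apply]
        exact N.gen_homotopy (h.cons b) A⟩

theorem envTransport_gen {a o o' : K} (b : OneSimplex o o') (p : PosetPath a o) (A : N.fibre a) :
    N.envTransport b (N.gen p A) = N.gen (.cons b p) A := by
  have : N.envTransport b (N.gen p A) = FreeAlgebra.lift ℂ
      (fun g : N.EnvGen o => N.gen (.cons b g.path) g.elt) (N.freeGen p A) :=
    RingQuot.liftAlgHom_mkAlgHom_apply ℂ _ _ _
  rw [this]
  simp [freeGen]

theorem envTransport_star {o o' : K} (b : OneSimplex o o') (x : N.EnvAlg o) :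
    N.envTransport b (star x) = star (N.envTransport b x) := by
  induction x using env_induction with
  | scalar z => simp [star_scalar]
  | gen p A => rw [star_gen, envTransport_gen, envTransport_gen, star_gen]
  | mul x y hx hy => simp [hx, hy]
  | add x y hx hy => simp [hx, hy]

theorem envTransport_opp {o o' : K} (b : OneSimplex o o') (x : N.EnvAlg o) :
    N.envTransport b.opp (N.envTransport b x) = x := by
  induction x using env_induction with
  | scalar z => simp
  | gen p A =>
    rw [envTransport_gen, envTransport_gen]
    exact N.gen_homotopy (PosetPath.homotopic_opp b p) A
  | mul x y hx hy => simp [hx, hy]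
  | add x y hx hy => simp [hx, hy]

theorem envTransport_nerve {a o e : K} (h : a ≤ o) (h' : o ≤ e) (x : N.EnvAlg a) :
    N.envTransport (.nerve h') (N.envTransport (.nerve h) x) =
      N.envTransport (.nerve (h.trans h')) x := by
  induction x using env_induction with
  | scalar z => simp
  | gen p A =>
    rw [envTransport_gen, envTransport_gen, envTransport_gen]
    exact N.gen_homotopy (PosetPath.homotopic_nerve h h' p) A
  | mul x y hx hy => simp [hx, hy]
  | add x y hx hy => simp [hx, hy]

/-! ### The enveloping seminorm -/

/-- A morphism from the net bundle of *-algebras generated by `N` to a net `B`. -/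
structure EnvHom (B : CStarNet.{u, w} K) where
  map : ∀ o : K, N.EnvAlg o →⋆ₙₐ[ℂ] B.fibre o
  map_incl : ∀ {a o : K} (h : a ≤ o) (x : N.EnvAlg a),
    map o (N.envTransport (.nerve h) x) = B.incl h (map a x)

/-- The values `‖π_o(W)‖`, for all morphisms `π` into C*-net bundles. -/
def envNormSet {o : K} (W : N.EnvAlg o) : Set ℝ :=
  {r | ∃ B : CStarNet.{u, max u v} K, B.IsBundle ∧ ∃ φ : N.EnvHom B, r = ‖φ.map o W‖}

/-- The seminorm `‖W‖ = sup_π ‖π_o(W)‖`. -/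
noncomputable def envNorm {o : K} (W : N.EnvAlg o) : ℝ := sSup (N.envNormSet W)

/-- The *-morphism `A ↦ π_o(p, A)`. -/
noncomputable def EnvHom.onGen {N : CStarNet.{u, v} K} {B : CStarNet.{u, w} K} (φ : N.EnvHom B)
    {a o : K} (p : PosetPath a o) : N.fibre a →⋆ₙₐ[ℂ] B.fibre o where
  toFun A := φ.map o (N.gen p A)
  map_smul' z A := by simp [gen_smul]
  map_zero' := by simp [gen_zero]
  map_add' A B := by simp [gen_add]
  map_mul' A B := by simp [gen_mul]
  map_star' A := by rw [← star_gen, map_star]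

theorem EnvHom.norm_one_le {N : CStarNet.{u, v} K} {B : CStarNet.{u, w} K} (φ : N.EnvHom B)
    (o : K) : ‖φ.map o 1‖ ≤ 1 := by
  have h : ‖φ.map o 1‖ * ‖φ.map o 1‖ = ‖φ.map o 1‖ := by
    rw [← CStarRing.norm_star_mul_self, ← map_star, ← map_mul, star_one, one_mul]
  nlinarith [norm_nonneg (φ.map o 1)]

theorem exists_norm_le {o : K} (W : N.EnvAlg o) :
    ∃ C : ℝ, ∀ (B : CStarNet.{u, max u v} K) (φ : N.EnvHom B), ‖φ.map o W‖ ≤ C := by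
  induction W using env_induction with
  | scalar z =>
    refine ⟨‖z‖, fun B φ => ?_⟩
    rw [Algebra.algebraMap_eq_smul_one, map_smul, norm_smul]
    exact mul_le_of_le_one_right (norm_nonneg _) (φ.norm_one_le o)
  | gen p A => exact ⟨‖A‖, fun B φ => NonUnitalStarAlgHom.norm_apply_le (φ.onGen p) A⟩
  | mul x y hx hy =>
    obtain ⟨C, hC⟩ := hx
    obtain ⟨D, hD⟩ := hy
    refine ⟨C * D, fun B φ => ?_⟩
    rw [map_mul]
    exact (norm_mul_le _ _).trans
      (mul_le_mul (hC B φ) (hD B φ) (norm_nonneg _) ((norm_nonneg _).trans (hC B φ)))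
  | add x y hx hy =>
    obtain ⟨C, hC⟩ := hx
    obtain ⟨D, hD⟩ := hy
    refine ⟨C + D, fun B φ => ?_⟩
    rw [map_add]
    exact (norm_add_le _ _).trans (add_le_add (hC B φ) (hD B φ))

theorem le_envNorm {o : K} (W : N.EnvAlg o) {B : CStarNet.{u, max u v} K} (hB : B.IsBundle)
    (φ : N.EnvHom B) : ‖φ.map o W‖ ≤ N.envNorm W := by
  obtain ⟨C, hC⟩ := N.exists_norm_le W
  refine le_csSup ⟨C, ?_⟩ ⟨B, hB, φ, rfl⟩
  rintro r ⟨B, _, φ, rfl⟩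
  exact hC B φ

theorem envNorm_nonneg {o : K} (W : N.EnvAlg o) : 0 ≤ N.envNorm W :=
  Real.sSup_nonneg (by rintro r ⟨B, _, φ, rfl⟩; exact norm_nonneg _)

theorem envNorm_le {o : K} {W : N.EnvAlg o} {C : ℝ} (hC : 0 ≤ C)
    (h : ∀ B : CStarNet.{u, max u v} K, B.IsBundle → ∀ φ : N.EnvHom B, ‖φ.map o W‖ ≤ C) :
    N.envNorm W ≤ C :=
  Real.sSup_le (by rintro r ⟨B, hB, φ, rfl⟩; exact h B hB φ) hC

theorem envNorm_mul_le {o : K} (x y : N.EnvAlg o) :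
    N.envNorm (x * y) ≤ N.envNorm x * N.envNorm y := by
  refine N.envNorm_le (mul_nonneg (N.envNorm_nonneg _) (N.envNorm_nonneg _)) fun B hB φ => ?_
  rw [map_mul]
  exact (norm_mul_le _ _).trans (mul_le_mul (N.le_envNorm x hB φ) (N.le_envNorm y hB φ)
    (norm_nonneg _) (N.envNorm_nonneg _))

theorem envNorm_smul_le {o : K} (z : ℂ) (x : N.EnvAlg o) :
    N.envNorm (z • x) ≤ ‖z‖ * N.envNorm x := by
  refine N.envNorm_le (mul_nonneg (norm_nonneg _) (N.envNorm_nonneg _)) fun B hB φ => ?_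
  rw [map_smul, norm_smul]
  exact mul_le_mul_of_nonneg_left (N.le_envNorm x hB φ) (norm_nonneg _)

theorem envNorm_star {o : K} (x : N.EnvAlg o) : N.envNorm (star x) = N.envNorm x := by
  have key : ∀ y : N.EnvAlg o, N.envNorm (star y) ≤ N.envNorm y := fun y =>
    N.envNorm_le (N.envNorm_nonneg _) fun B hB φ => by
      rw [map_star, norm_star]; exact N.le_envNorm y hB φ
  exact le_antisymm (key x) (by simpa using key (star x))

theorem envNorm_mul_self_le {o : K} (x : N.EnvAlg o) :
    N.envNorm x * N.envNorm x ≤ N.envNorm (star x * x) := by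
  have h : N.envNorm x ≤ √(N.envNorm (star x * x)) := by
    refine N.envNorm_le (Real.sqrt_nonneg _) fun B hB φ => Real.le_sqrt_of_sq_le ?_
    rw [sq, ← CStarRing.norm_star_mul_self, ← map_star, ← map_mul]
    exact N.le_envNorm _ hB φ
  calc N.envNorm x * N.envNorm x
      ≤ √(N.envNorm (star x * x)) * √(N.envNorm (star x * x)) :=
        mul_le_mul h h (N.envNorm_nonneg _) (Real.sqrt_nonneg _)
    _ = N.envNorm (star x * x) := Real.mul_self_sqrt (N.envNorm_nonneg _)

noncomputable instance (o : K) : SeminormedAddCommGroup (N.EnvAlg o) :=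
  AddGroupSeminorm.toSeminormedAddCommGroup
    { toFun := N.envNorm
      map_zero' := le_antisymm (N.envNorm_le le_rfl fun B _ φ => by simp) (N.envNorm_nonneg _)
      add_le' := fun x y =>
        N.envNorm_le (add_nonneg (N.envNorm_nonneg _) (N.envNorm_nonneg _)) fun B hB φ => by
          rw [map_add]
          exact (norm_add_le _ _).trans (add_le_add (N.le_envNorm x hB φ) (N.le_envNorm y hB φ))
      neg' := fun x => by simp [envNorm, envNormSet] }

noncomputable instance (o : K) : SeminormedRing (N.EnvAlg o) where
  __ := (inferInstance : Ring (N.EnvAlg o))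
  __ := (inferInstance : SeminormedAddCommGroup (N.EnvAlg o))
  norm_mul_le := N.envNorm_mul_le

noncomputable instance (o : K) : NormedAlgebra ℂ (N.EnvAlg o) where
  norm_smul_le := N.envNorm_smul_le

instance (o : K) : NormedStarGroup (N.EnvAlg o) where
  norm_star_le x := (N.envNorm_star x).le

theorem norm_envTransport {a o : K} (h : a ≤ o) (x : N.EnvAlg a) :
    ‖N.envTransport (.nerve h) x‖ = ‖x‖ := by
  change sSup _ = sSup _
  congr 1
  ext r
  have key (B : CStarNet.{u, max u v} K) (φ : N.EnvHom B) :
      ‖φ.map o (N.envTransport (.nerve h) x)‖ = ‖φ.map a x‖ := by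
    rw [φ.map_incl]
    exact NonUnitalStarAlgHom.norm_map (B.incl h) (B.incl_injective h) _
  simp [envNormSet, key]

/-! ### The enveloping net bundle -/

/-- The fibre of the enveloping net bundle: the completion of the quotient of the *-algebra by
the elements of zero seminorm. -/
abbrev EnvFibre (o : K) : Type (max u v) := UniformSpace.Completion (N.EnvAlg o)

theorem uniformContinuous_envStar (o : K) :
    UniformContinuous (star : N.EnvAlg o → N.EnvAlg o) :=
  star_isometry.uniformContinuous

noncomputable instance (o : K) : Star (N.EnvFibre o) where
  star := UniformSpace.Completion.map star

theorem continuous_envFibre_star (o : K) :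
    Continuous (star : N.EnvFibre o → N.EnvFibre o) :=
  UniformSpace.Completion.continuous_map

theorem star_coe {o : K} (x : N.EnvAlg o) :
    star (x : N.EnvFibre o) = ((star x : N.EnvAlg o) : N.EnvFibre o) :=
  UniformSpace.Completion.map_coe (N.uniformContinuous_envStar o) x

open UniformSpace.Completion in
noncomputable instance (o : K) : StarRing (N.EnvFibre o) where
  star_involutive x := by
    have h := N.continuous_envFibre_star o
    induction x using UniformSpace.Completion.induction_on with
    | hp => exact isClosed_eq (h.comp h) continuous_id
    | ih x => rw [star_coe, star_coe, star_star]
  star_mul x y := by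
    have h := N.continuous_envFibre_star o
    induction x, y using UniformSpace.Completion.induction_on₂ with
    | hp => exact isClosed_eq (by fun_prop) (by fun_prop)
    | ih x y => rw [← coe_mul, star_coe, star_coe, star_coe, ← coe_mul, star_mul]
  star_add x y := by
    have h := N.continuous_envFibre_star o
    induction x, y using UniformSpace.Completion.induction_on₂ with
    | hp => exact isClosed_eq (by fun_prop) (by fun_prop)
    | ih x y => rw [← coe_add, star_coe, star_coe, star_coe, ← coe_add, star_add]

open UniformSpace.Completion in
theorem envFibre_norm_mul_self_le {o : K} (x : N.EnvFibre o) : ‖x‖ * ‖x‖ ≤ ‖star x * x‖ := by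
  have h := N.continuous_envFibre_star o
  induction x using UniformSpace.Completion.induction_on with
  | hp =>
    exact isClosed_le (continuous_norm.mul continuous_norm)
      (continuous_norm.comp (h.mul continuous_id))
  | ih x =>
    rw [star_coe, ← coe_mul, norm_coe, norm_coe]
    exact N.envNorm_mul_self_le x

open UniformSpace.Completion in
theorem envFibre_star_smul {o : K} (z : ℂ) (x : N.EnvFibre o) : star (z • x) = star z • star x := by
  have h := N.continuous_envFibre_star o
  induction x using UniformSpace.Completion.induction_on with
  | hp =>
    exact isClosed_eq (h.comp (continuous_const_smul z))
      ((continuous_const_smul (star z)).comp h)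
  | ih x => rw [← coe_smul, star_coe, star_coe, ← coe_smul, star_smul]

noncomputable instance (o : K) : CStarAlgebra (N.EnvFibre o) where
  norm_mul_self_le x := N.envFibre_norm_mul_self_le x
  norm_smul_le := norm_smul_le
  star_smul z x := N.envFibre_star_smul z x

theorem continuous_envTransport {a o : K} (h : a ≤ o) :
    Continuous (N.envTransport (.nerve h)) :=
  (AddMonoidHomClass.isometry_of_norm _ (N.norm_envTransport h)).continuous

theorem map_envTransport_coe {a o : K} (h : a ≤ o) (x : N.EnvAlg a) :
    UniformSpace.Completion.map (N.envTransport (.nerve h)) (x : N.EnvFibre a) =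
      (N.envTransport (.nerve h) x : N.EnvFibre o) :=
  UniformSpace.Completion.map_coe
    (AddMonoidHomClass.isometry_of_norm _ (N.norm_envTransport h)).uniformContinuous x

open UniformSpace.Completion in
/-- The inclusion maps of the enveloping net bundle: the continuous extensions of
`(p, A) ↦ ((o a) * p, A)`. -/
noncomputable def envIncl {a o : K} (h : a ≤ o) : N.EnvFibre a →⋆ₐ[ℂ] N.EnvFibre o where
  __ := mapRingHom (N.envTransport (.nerve h)).toRingHom (N.continuous_envTransport h)
  commutes' z := by
    change UniformSpace.Completion.map (N.envTransport (.nerve h))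
      ((algebraMap ℂ (N.EnvAlg a) z : N.EnvAlg a) : N.EnvFibre a) = _
    rw [map_envTransport_coe, AlgHom.commutes]
    rfl
  map_star' x := by
    change UniformSpace.Completion.map (N.envTransport (.nerve h)) (star x) =
      star (UniformSpace.Completion.map (N.envTransport (.nerve h)) x)
    have h1 := N.continuous_envFibre_star a
    have h2 := N.continuous_envFibre_star o
    induction x using UniformSpace.Completion.induction_on with
    | hp => exact isClosed_eq (continuous_map.comp h1) (h2.comp continuous_map)
    | ih x =>
      rw [star_coe, map_envTransport_coe, map_envTransport_coe, star_coe, envTransport_star]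

theorem envIncl_coe {a o : K} (h : a ≤ o) (x : N.EnvAlg a) :
    N.envIncl h (x : N.EnvFibre a) = (N.envTransport (.nerve h) x : N.EnvFibre o) :=
  N.map_envTransport_coe h x

theorem continuous_envIncl {a o : K} (h : a ≤ o) : Continuous (N.envIncl h) :=
  UniformSpace.Completion.continuous_map

theorem norm_envIncl {a o : K} (h : a ≤ o) (x : N.EnvFibre a) : ‖N.envIncl h x‖ = ‖x‖ := by
  have hc := N.continuous_envIncl h
  induction x using UniformSpace.Completion.induction_on with
  | hp => exact isClosed_eq (by fun_prop) (by fun_prop)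
  | ih x =>
    rw [envIncl_coe, UniformSpace.Completion.norm_coe, UniformSpace.Completion.norm_coe,
      norm_envTransport]

/-- The enveloping net bundle of a net. -/
noncomputable def enveloping : CStarNet.{u, max u v} K where
  fibre := N.EnvFibre
  incl h := N.envIncl h
  incl_injective h := (AddMonoidHomClass.isometry_of_norm _ (N.norm_envIncl h)).injective
  incl_incl h h' x := by
    have h1 := N.continuous_envIncl h
    have h2 := N.continuous_envIncl h'
    have h3 := N.continuous_envIncl (h.trans h')
    induction x using UniformSpace.Completion.induction_on with
    | hp => exact isClosed_eq (by fun_prop) (by fun_prop)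
    | ih x => rw [envIncl_coe, envIncl_coe, envIncl_coe, envTransport_nerve]

theorem enveloping_isBundle : N.enveloping.IsBundle := by
  intro a o h
  refine ⟨N.enveloping.incl_injective h, fun y => ?_⟩
  have hc : IsClosed (Set.range (N.envIncl h)) :=
    (AddMonoidHomClass.isometry_of_norm _ (N.norm_envIncl h)).isClosedEmbedding.isClosed_range
  refine UniformSpace.Completion.induction_on (p := fun y => y ∈ Set.range (N.envIncl h)) y hc
    fun x => ⟨(N.envTransport (OneSimplex.nerve h).opp x : N.EnvAlg a), ?_⟩
  rw [envIncl_coe]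
  exact congrArg _ (N.envTransport_opp (OneSimplex.nerve h).opp x)

/-- The canonical embedding `ε` of a net into its enveloping net bundle,
`ε_o(A) = (ι_o, A)` with `ι_o` the trivial loop over `o`. -/
noncomputable def canonicalEmbedding : Hom N N.enveloping where
  map o :=
    { toFun := fun A => ((N.gen (.trivial o) A : N.EnvAlg o) : N.EnvFibre o)
      map_smul' := fun z A => by rw [gen_smul]; exact UniformSpace.Completion.coe_smul _ _
      map_zero' := by rw [gen_zero]; exact UniformSpace.Completion.coe_zero
      map_add' := fun A B => by rw [gen_add]; exact UniformSpace.Completion.coe_add _ _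
      map_mul' := fun A B => by rw [gen_mul]; exact UniformSpace.Completion.coe_mul _ _
      map_star' := fun A => by rw [← star_gen]; exact (N.star_coe _).symm }
  map_incl {a o} h A := by
    change ((N.gen (.trivial o) (N.incl h A) : N.EnvAlg o) : N.EnvFibre o) =
      N.envIncl h ((N.gen (.trivial a) A : N.EnvAlg a) : N.EnvFibre a)
    rw [envIncl_coe, PosetPath.trivial, PosetPath.trivial, envTransport_gen, gen_isotony]
    refine congrArg _ (N.gen_homotopy ?_ A)
    exact .trans _ _ _ (PosetPath.homotopic_degenerate _)
      (.symm _ _ (.rel _ _ (.single ⟨.nerve h, .nerve h, .degenerate a, o, le_rfl, le_rfl, h⟩)))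

theorem canonicalEmbedding_isUnital : N.canonicalEmbedding.IsUnital := fun o =>
  (congrArg _ (N.gen_one (.trivial o))).trans (UniformSpace.Completion.coe_one _)

/-- A net is nondegenerate if its enveloping net bundle does not vanish. -/
def IsNondegenerate : Prop := ¬ N.enveloping.Vanishes

/-- A net is injective if it is nondegenerate and its canonical embedding into the enveloping
net bundle is a monomorphism. -/
def IsInjective : Prop := N.IsNondegenerate ∧ N.canonicalEmbedding.IsMono

/-! ### Representations -/

/-- A representation `(π, U)` of a net: Hilbert space representations `π_o` of the fibres
and unitary inclusion operators `U_{oa} : H_a → H_o`, `a ≤ o`, intertwining `π_a` and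
`π_o ∘ j_{oa}` and satisfying the cocycle relation. -/
structure Representation where
  space : K → Type w
  [normed : ∀ o, NormedAddCommGroup (space o)]
  [inner : ∀ o, InnerProductSpace ℂ (space o)]
  [complete : ∀ o, CompleteSpace (space o)]
  rep : ∀ o, N.fibre o →⋆ₙₐ[ℂ] (space o →L[ℂ] space o)
  op : ∀ {a o : K}, a ≤ o → space a ≃ₗᵢ[ℂ] space o
  op_rep : ∀ {a o : K} (h : a ≤ o) (A : N.fibre a) (x : space a),
    op h (rep a A x) = rep o (N.incl h A) (op h x)
  op_op : ∀ {e a o : K} (h : e ≤ a) (h' : a ≤ o) (x : space e),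
    op h' (op h x) = op (h.trans h') x

attribute [instance] Representation.normed Representation.inner Representation.complete

variable {N} in
/-- A representation is faithful if every `π_o` is faithful. -/
def Representation.IsFaithful (R : N.Representation) : Prop :=
  ∀ o : K, Function.Injective (R.rep o)

variable {N} in
/-- A representation vanishes if `π_o(A) = 0` for all `o` and `A`. -/
def Representation.Vanishes (R : N.Representation) : Prop :=
  ∀ (o : K) (A : N.fibre o), R.rep o A = 0

end Nets

end CStarNet

/-! Both equivalences compare the kernels of representations with the kernel of the canonical
embedding `ε`.

Every representation satisfies `ker ε_o ⊆ ker π_o`. Cutting each Hilbert space down to the range of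
`π_o(1)` makes `π` unital without changing its kernels. A 1-simplex `b : a → o` acts by the unitary
`U_b = U_{|b|o}⁻¹ U_{|b|a}`; by the cocycle relation the product `U_p` along a path depends only on
its homotopy class. Hence `(p, A) ↦ U_p π_a(A) U_p*` respects the defining relations and is a
morphism into the C*-net bundle of the algebras `B(H_o)`. It takes part in the supremum defining the
seminorm, so it kills elements of zero seminorm; on `(ι_o, A)` it is a unitary conjugate of
`π_o(A)`. This is `Representation.rep_eq_zero_of_canonicalEmbedding_eq_zero`.

Conversely, some representation has `ker π_o = ker ε_o`. The inclusion maps of the enveloping bundle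
are *-isomorphisms, and the direct sum of the GNS representations over all positive functionals is
faithful (`universalRep_injective`) and strictly functorial for *-isomorphisms, since pullback
permutes the functionals. No choice is involved, so the resulting unitaries satisfy the cocycle
relation exactly. Composing with `ε` gives `Hom.universalRepresentation`. -/

namespace CStarNet

namespace Representation

variable {K : Type u} [PartialOrder K] {N : CStarNet.{u, v} K}

/-! ## The unital part of a representation -/

variable (R : Representation.{u, v, w} N)

/-- The essential subspace of a representation over `o`: the range of the projection `π_o(1)`. -/
noncomputable def essential (o : K) : Submodule ℂ (R.space o) := (1 - R.rep o 1).ker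

theorem mem_essential {o : K} {x : R.space o} : x ∈ R.essential o ↔ R.rep o 1 x = x := by
  rw [essential, LinearMap.mem_ker]
  exact sub_eq_zero.trans eq_comm

theorem rep_mem_essential {o : K} (A : N.fibre o) (x : R.space o) :
    R.rep o A x ∈ R.essential o := by
  rw [mem_essential, ← mul_apply_eq_comp, ← map_mul, one_mul]

theorem rep_rep_one {o : K} (A : N.fibre o) (x : R.space o) :
    R.rep o A (R.rep o 1 x) = R.rep o A x := by
  rw [← mul_apply_eq_comp, ← map_mul, mul_one]

instance (o : K) : CompleteSpace (R.essential o) :=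
  (ContinuousLinearMap.isClosed_ker (1 - R.rep o 1)).completeSpace_coe

/-- The inclusion maps are unital, so `U_{oa}` intertwines `π_a(1)` and `π_o(1)`. With the converse
for the inverse, it restricts to a unitary between the essential subspaces. -/
theorem op_mem_essential {a o : K} (h : a ≤ o) {x : R.space a} (hx : x ∈ R.essential a) :
    R.op h x ∈ R.essential o := by
  rw [mem_essential] at hx ⊢
  rw [← map_one (N.incl h), ← R.op_rep, hx]

theorem op_symm_mem_essential {a o : K} (h : a ≤ o) {x : R.space o} (hx : x ∈ R.essential o) :
    (R.op h).symm x ∈ R.essential a := by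
  rw [mem_essential] at hx ⊢
  apply (R.op h).injective
  rw [R.op_rep, map_one, (R.op h).apply_symm_apply, hx]

/-- The restriction of `π_o(A)` to the essential subspace. -/
noncomputable def essentialRep (o : K) (A : N.fibre o) : R.essential o →L[ℂ] R.essential o :=
  ((R.rep o A).comp (R.essential o).subtypeL).codRestrict (R.essential o)
    fun x => R.rep_mem_essential A x

@[simp]
theorem coe_essentialRep {o : K} (A : N.fibre o) (x : R.essential o) :
    (R.essentialRep o A x : R.space o) = R.rep o A x := rfl

/-- The restriction of a representation to its essential subspaces. -/
noncomputable def unitalPart : Representation.{u, v, w} N where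
  space o := R.essential o
  rep o :=
    { toFun := R.essentialRep o
      map_smul' := fun z A => by ext x; simp
      map_zero' := by ext x; simp
      map_add' := fun A B => by ext x; simp
      map_mul' := fun A B => by ext x; simp
      map_star' := fun A => by
        rw [ContinuousLinearMap.star_eq_adjoint, ContinuousLinearMap.eq_adjoint_iff]
        intro x y
        simp [map_star, ContinuousLinearMap.star_eq_adjoint,
          ContinuousLinearMap.adjoint_inner_left] }
  op {a o} h :=
    { toFun := fun x => ⟨R.op h x, R.op_mem_essential h x.2⟩
      invFun := fun x => ⟨(R.op h).symm x, R.op_symm_mem_essential h x.2⟩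
      map_add' := fun x y => by ext; simp
      map_smul' := fun z x => by ext; simp
      left_inv := fun x => by ext; simp
      right_inv := fun x => by ext; simp
      norm_map' := fun x => (R.op h).norm_map x }
  op_rep h A x := Subtype.ext (R.op_rep h A x)
  op_op h h' x := Subtype.ext (R.op_op h h' x)

theorem unitalPart_rep_one (o : K) : R.unitalPart.rep o 1 = 1 := by
  ext x
  exact Subtype.ext (R.mem_essential.1 x.2)

/-- Since `π_o(A) = π_o(A) π_o(1)`, nothing is lost by restricting to the range of `π_o(1)`. -/
theorem unitalPart_rep_eq_zero_iff {o : K} (A : N.fibre o) :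
    R.unitalPart.rep o A = 0 ↔ R.rep o A = 0 := by
  refine ⟨fun h => ?_, fun h => ?_⟩
  · ext x
    rw [← R.rep_rep_one]
    exact congrArg Subtype.val
      (DFunLike.congr_fun h (⟨R.rep o 1 x, R.rep_mem_essential 1 x⟩ : R.essential o))
  · ext x
    exact Subtype.ext (DFunLike.congr_fun h (R.essential o |>.subtype x))

/-! ## Parallel transport -/

theorem op_refl (o : K) (x : R.space o) : R.op (le_refl o) x = x :=
  -- The cocycle relation makes `U_{oo}` idempotent, and an injective idempotent is the identity.
  (R.op (le_refl o)).injective (R.op_op le_rfl le_rfl x)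

/-- The unitary associated with a 1-simplex. -/
noncomputable def simplexOp {a o : K} (b : OneSimplex a o) : R.space a ≃ₗᵢ[ℂ] R.space o :=
  (R.op b.le_source).trans (R.op b.le_target).symm

/-- Any element above the support can replace it in the definition of `U_b`, so several simplices
can be compared inside one space. -/
theorem op_simplexOp {a o s : K} (b : OneSimplex a o) (h : b.supp ≤ s) (x : R.space a) :
    R.op (b.le_target.trans h) (R.simplexOp b x) = R.op (b.le_source.trans h) x := by
  rw [← R.op_op b.le_target h, simplexOp, LinearIsometryEquiv.trans_apply,
    LinearIsometryEquiv.apply_symm_apply, R.op_op]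

theorem simplexOp_nerve {a o : K} (h : a ≤ o) (x : R.space a) :
    R.simplexOp (.nerve h) x = R.op h x :=
  (R.op_refl o _).symm.trans (R.op_simplexOp (.nerve h) le_rfl x)

theorem simplexOp_face {a e o : K} (c : TwoSimplex a e o) (x : R.space a) :
    R.simplexOp c.face0 (R.simplexOp c.face2 x) = R.simplexOp c.face1 x := by
  -- After transport to the space over `|c|`, each face acts trivially.
  apply (R.op (c.face0.le_target.trans c.le0)).injective
  rw [R.op_simplexOp c.face0 c.le0, R.op_simplexOp c.face1 c.le1, R.op_simplexOp c.face2 c.le2]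

/-- The unitary associated with a path. -/
noncomputable def pathOp : {a o : K} → PosetPath a o → (R.space a ≃ₗᵢ[ℂ] R.space o)
  | _, _, .single b => R.simplexOp b
  | _, _, .cons b p => (pathOp p).trans (R.simplexOp b)

theorem pathOp_deformation {a o : K} {p q : PosetPath a o} (h : p.Deformation q) :
    R.pathOp p = R.pathOp q := by
  induction h with
  | single c => ext x; simp [pathOp, simplexOp_face]
  | cons c p => ext x; simp [pathOp, simplexOp_face]
  | left b _ ih => simp [pathOp, ih]

theorem pathOp_homotopic {a o : K} {p q : PosetPath a o} (h : p.Homotopic q) :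
    R.pathOp p = R.pathOp q := by
  induction h with
  | rel _ _ h => exact R.pathOp_deformation h
  | refl _ => rfl
  | symm _ _ _ ih => exact ih.symm
  | trans _ _ _ _ _ ih1 ih2 => exact ih1.trans ih2

theorem pathOp_comp {a e o : K} (p : PosetPath a e) (q : PosetPath e o) :
    R.pathOp (p.comp q) = (R.pathOp p).trans (R.pathOp q) := by
  induction q with
  | single b => simp only [PosetPath.comp, pathOp]
  | cons b q ih =>
    simp only [PosetPath.comp, pathOp, ih]
    rfl

/-! ## The morphism into a C*-net bundle induced by a unital representation -/

/-- The net bundle of the algebras `B(H_o)`, with inclusion maps `Ad U_{oa}`. -/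
noncomputable def operatorBundle : CStarNet.{u, w} K where
  fibre o := R.space o →L[ℂ] R.space o
  incl h := (R.op h).conjStarAlgEquiv.toStarAlgHom
  incl_injective h := (R.op h).conjStarAlgEquiv.injective
  incl_incl h h' A := by
    have key : (R.op h).trans (R.op h') = R.op (h.trans h') := by ext x; exact R.op_op h h' x
    change (R.op h').conjStarAlgEquiv ((R.op h).conjStarAlgEquiv A) = _
    rw [← key, LinearIsometryEquiv.conjStarAlgEquiv_trans]
    rfl

theorem operatorBundle_isBundle : R.operatorBundle.IsBundle := fun h =>
  EquivLike.bijective (R.op h).conjStarAlgEquiv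

/-- The operator `U_p π_a(A) U_p*`. -/
noncomputable def genOp {a o : K} (p : PosetPath a o) (A : N.fibre a) :
    R.space o →L[ℂ] R.space o :=
  (R.pathOp p).conjStarAlgEquiv (R.rep a A)

-- Conjugation by `U_p` is a *-isomorphism, which settles the algebraic relations; isotony is the
-- intertwining property, and homotopy invariance is that of `U_p`.
variable {R} in
theorem lift_envRel (hR : ∀ o, R.rep o 1 = 1) {o : K} ⦃x y : FreeAlgebra ℂ (N.EnvGen o)⦄
    (h : N.EnvRel o x y) :
    FreeAlgebra.lift ℂ (fun g : N.EnvGen o => R.genOp g.path g.elt) x =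
      FreeAlgebra.lift ℂ (fun g : N.EnvGen o => R.genOp g.path g.elt) y := by
  induction h with
  | mul p A B => simp [freeGen, genOp]
  | add p A B => simp [freeGen, genOp]
  | smul p z A => simp [freeGen, genOp]
  -- The one relation that needs a unital representation, hence the passage to `unitalPart`.
  | one p => simp [freeGen, genOp, hR]
  | zero p => simp [freeGen, genOp]
  | isotony h p A =>
    simp only [freeGen, FreeAlgebra.lift_ι_apply, genOp]
    -- As `U_{p*(a'a)} = U_p U_{a'a}`, the intertwining relation applied to `U_{a'a}⁻¹ U_p⁻¹ x`
    -- identifies the two sides.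
    ext x
    simp [pathOp_comp, pathOp, LinearIsometryEquiv.conjStarAlgEquiv_apply_apply, simplexOp_nerve, op_rep]
    rw [← simplexOp_nerve]
    simp
  | homotopy h A => simp [freeGen, genOp, R.pathOp_homotopic h]

variable {R} in
/-- The extension of `(p, A) ↦ U_p π_a(A) U_p*` to a morphism. -/
noncomputable def envRep (hR : ∀ o, R.rep o 1 = 1) (o : K) :
    N.EnvAlg o →ₐ[ℂ] (R.space o →L[ℂ] R.space o) :=
  RingQuot.liftAlgHom ℂ (s := N.EnvRel o) ⟨_, lift_envRel hR⟩

theorem envRep_gen (hR : ∀ o, R.rep o 1 = 1) {a o : K} (p : PosetPath a o) (A : N.fibre a) :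
    envRep hR o (N.gen p A) = R.genOp p A := by
  have : envRep hR o (N.gen p A) = FreeAlgebra.lift ℂ
      (fun g : N.EnvGen o => R.genOp g.path g.elt) (N.freeGen p A) :=
    RingQuot.liftAlgHom_mkAlgHom_apply ℂ _ _ _
  rw [this]
  simp [freeGen]

theorem envRep_star (hR : ∀ o, R.rep o 1 = 1) {o : K} (x : N.EnvAlg o) :
    envRep hR o (star x) = star (envRep hR o x) := by
  induction x using env_induction with
  | scalar z => simp [Algebra.algebraMap_eq_smul_one]
  | gen p A => rw [star_gen, envRep_gen, envRep_gen, genOp, genOp, map_star, map_star]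
  | mul x y hx hy => simp [hx, hy]
  | add x y hx hy => simp [hx, hy]

/-- The morphism into the net bundle of the algebras `B(H_o)`. -/
noncomputable def envHom (hR : ∀ o, R.rep o 1 = 1) : N.EnvHom R.operatorBundle where
  map o :=
    { toFun := envRep hR o
      map_mul' := map_mul (envRep hR o)
      map_add' := map_add (envRep hR o)
      map_zero' := map_zero (envRep hR o)
      map_smul' := map_smul (envRep hR o)
      map_star' := R.envRep_star hR }
  map_incl {a o} h x := by
    change envRep hR o (N.envTransport (.nerve h) x) =
      (R.op h).conjStarAlgEquiv (envRep hR a x)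
    induction x using env_induction with
    | scalar z => simp [Algebra.algebraMap_eq_smul_one]
    | gen p A =>
      rw [envTransport_gen, envRep_gen, envRep_gen]
      have key : R.simplexOp (.nerve h) = R.op h := by ext x; exact R.simplexOp_nerve h x
      rw [genOp, pathOp, key, LinearIsometryEquiv.conjStarAlgEquiv_trans]
      rfl
    | mul x y hx hy => simp [hx, hy]
    | add x y hx hy => simp [hx, hy]

end Representation

/-! ### Kernels of representations versus the kernel of the canonical embedding -/

section

variable {K : Type u} [PartialOrder K] {N : CStarNet.{u, v} K}

/-- A norm-null element of the generated *-algebra is annihilated by unital representations. -/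
theorem Representation.envRep_eq_zero (R : Representation.{u, v, max u v} N)
    (hR : ∀ o, R.rep o 1 = 1) {o : K} {x : N.EnvAlg o} (hx : (x : N.EnvFibre o) = 0) :
    Representation.envRep hR o x = 0 := by
  have h0 : N.envNorm x = 0 := by
    have : ‖(x : N.EnvFibre o)‖ = ‖x‖ := UniformSpace.Completion.norm_coe x
    rw [hx, norm_zero] at this
    exact this.symm
  refine norm_le_zero_iff.1 (h0 ▸ ?_)
  -- The Hilbert spaces lie in universe `max u v`, so the bundle of the `B(H_o)` is among those over
  -- which the supremum is taken.
  exact N.le_envNorm x R.operatorBundle_isBundle (R.envHom hR)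

/-- A representation annihilates the kernel of the canonical embedding. -/
theorem Representation.rep_eq_zero_of_canonicalEmbedding_eq_zero
    (R : Representation.{u, v, max u v} N) {o : K} {A : N.fibre o}
    (hA : N.canonicalEmbedding.map o A = 0) : R.rep o A = 0 := by
  rw [← R.unitalPart_rep_eq_zero_iff]
  -- By definition `ε_o(A)` is the class of `(ι_o, A)`, so `hA` is already the required nullity. The
  -- value there is a unitary conjugate of `π_o(A)`.
  have h := R.unitalPart.envRep_eq_zero R.unitalPart_rep_one hA
  rw [envRep_gen, genOp, EmbeddingLike.map_eq_zero_iff] at h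
  exact h

theorem Representation.isNondegenerate (R : Representation.{u, v, max u v} N)
    (hR : ¬ R.Vanishes) : N.IsNondegenerate := by
  intro h
  refine hR fun o A => R.rep_eq_zero_of_canonicalEmbedding_eq_zero ?_
  exact (h o).elim _ _

theorem Representation.isInjective (R : Representation.{u, v, max u v} N)
    (hN : ¬ N.Vanishes) (hR : R.IsFaithful) : N.IsInjective := by
  -- A faithful representation that vanishes would force every fibre to be `{0}`.
  refine ⟨R.isNondegenerate fun h => hN fun o => ⟨fun A B => hR o ?_⟩, fun o => ?_⟩
  · rw [h o A, h o B]
  · refine (injective_iff_map_eq_zero _).2 fun A hA => hR o ?_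
    rw [R.rep_eq_zero_of_canonicalEmbedding_eq_zero hA, map_zero]

end

end CStarNet

/-! ## The universal representation of a C*-algebra -/

section Universal

open scoped ComplexOrder
open UniformSpace

namespace PositiveLinearMap

/-! ### Positive functionals separate points -/

section Separation

variable {A : Type*} [CStarAlgebra A] [PartialOrder A] [StarOrderedRing A]

/-- The positive linear functionals separate the points of a C*-algebra. -/
theorem exists_apply_star_mul_self_ne_zero {a : A} (ha : a ≠ 0) :
    ∃ f : A →ₚ[ℂ] ℂ, f (star a * a) ≠ 0 := by
  -- Otherwise `0 ≤ star a * a ≤ 0`, and the C*-identity gives `a = 0`.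
  have hmem : -(star a * a) ∉ ProperCone.positive ℝ A := fun h => by
    have h1 : star a * a ≤ 0 := by simpa using h
    exact ha (CStarRing.star_mul_self_eq_zero_iff a |>.1
      (le_antisymm h1 (star_mul_self_nonneg a)))
  obtain ⟨g, hg, hga⟩ := (ProperCone.positive ℝ A).hyperplane_separation_point hmem
  -- The separating functional `g` is only real linear. Composing it with the real part and
  -- extending by `x ↦ r x - i r (i x)` gives a complex linear functional with the same values on
  -- positive elements.
  let r : Module.Dual ℝ A := g.toLinearMap ∘ₗ (selfAdjoint.submodule ℝ A).subtype ∘ₗ realPart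
  have hr : ∀ x : A, 0 ≤ x → r.extendRCLike (𝕜 := ℂ) x = (g x : ℂ) := fun x hx => by
    have hs : IsSelfAdjoint x := .of_nonneg hx
    rw [Module.Dual.extendRCLike_apply]
    have h1 : r x = g x := congrArg g hs.coe_realPart
    -- The real part of `i x` is minus the imaginary part of `x`, which is zero for selfadjoint `x`.
    have h2 : r ((RCLike.I : ℂ) • x) = 0 := by
      have : realPart (Complex.I • x) = 0 := by
        rw [realPart_I_smul, hs.imaginaryPart, neg_zero]
      change g ((realPart (Complex.I • x) : selfAdjoint A) : A) = 0
      rw [this]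
      exact map_zero g
    rw [h1, h2]
    simp
  refine ⟨.mk₀ (r.extendRCLike (𝕜 := ℂ)) fun x hx => ?_, ?_⟩
  · rw [hr x hx]
    exact Complex.zero_le_real.2 (hg x hx)
  · change r.extendRCLike (𝕜 := ℂ) (star a * a) ≠ 0
    rw [hr _ (star_mul_self_nonneg a)]
    rw [map_neg] at hga
    exact_mod_cast (neg_neg_iff_pos.1 hga).ne'

/-- The operator of `a` sends the class of `1` to the class of `a`, whose squared norm is `f (star a
* a)`. -/
theorem gnsNonUnitalStarAlgHom_ne_zero {f : A →ₚ[ℂ] ℂ} {a : A} (h : f (star a * a) ≠ 0) :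
    f.gnsNonUnitalStarAlgHom a ≠ 0 := by
  intro h0
  have h1 : f.gnsNonUnitalStarAlgHom a (f.toPreGNS 1 : f.GNS) = (f.toPreGNS a : f.GNS) := by
    simp
  rw [h0, _root_.zero_apply, eq_comm, ← norm_eq_zero, Completion.norm_coe] at h1
  apply h
  simpa [h1] using (f.preGNS_norm_sq (f.toPreGNS a)).symm

end Separation

/-! ### Functoriality of the GNS construction under *-isomorphisms -/

section Pullback

variable {A B C : Type*} [CStarAlgebra A] [PartialOrder A] [StarOrderedRing A]
  [CStarAlgebra B] [PartialOrder B] [StarOrderedRing B]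
  [CStarAlgebra C] [PartialOrder C] [StarOrderedRing C]

/-- The pullback of a positive functional along a *-isomorphism. -/
noncomputable def pullback (j : A ≃⋆ₐ[ℂ] B) (f : B →ₚ[ℂ] ℂ) : A →ₚ[ℂ] ℂ :=
  f.comp (.ofClass j)

@[simp]
theorem pullback_apply (j : A ≃⋆ₐ[ℂ] B) (f : B →ₚ[ℂ] ℂ) (a : A) :
    pullback j f a = f (j a) := rfl

/-- The bijection between positive functionals induced by a *-isomorphism. -/
noncomputable def pullbackEquiv (j : A ≃⋆ₐ[ℂ] B) : (B →ₚ[ℂ] ℂ) ≃ (A →ₚ[ℂ] ℂ) where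
  toFun := pullback j
  invFun := pullback j.symm
  left_inv f := by ext; simp
  right_inv f := by ext; simp

/-- The isometry between the pre-GNS spaces induced by a *-isomorphism. -/
noncomputable def preGNSMap (j : A ≃⋆ₐ[ℂ] B) (f : B →ₚ[ℂ] ℂ) :
    (pullback j f).PreGNS →ₗᵢ[ℂ] f.PreGNS where
  toFun x := f.toPreGNS (j ((pullback j f).ofPreGNS x))
  map_add' x y := by simp
  map_smul' z x := by simp
  norm_map' x := by simp [preGNS_norm_def, map_star]

/-- The isometry between the GNS spaces induced by a *-isomorphism. -/
noncomputable def gnsMap (j : A ≃⋆ₐ[ℂ] B) (f : B →ₚ[ℂ] ℂ) :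
    (pullback j f).GNS →L[ℂ] f.GNS :=
  (preGNSMap j f).toContinuousLinearMap.completion

theorem gnsMap_coe (j : A ≃⋆ₐ[ℂ] B) (f : B →ₚ[ℂ] ℂ) (x : (pullback j f).PreGNS) :
    gnsMap j f x = (f.toPreGNS (j ((pullback j f).ofPreGNS x)) : f.GNS) :=
  ContinuousLinearMap.completion_apply_coe _ _

theorem norm_gnsMap (j : A ≃⋆ₐ[ℂ] B) (f : B →ₚ[ℂ] ℂ) (x : (pullback j f).GNS) :
    ‖gnsMap j f x‖ = ‖x‖ := by
  induction x using Completion.induction_on with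
  | hp => exact isClosed_eq (by fun_prop) (by fun_prop)
  | ih x =>
    rw [gnsMap_coe, Completion.norm_coe, Completion.norm_coe]
    exact (preGNSMap j f).norm_map x

theorem gnsMap_refl (f : A →ₚ[ℂ] ℂ) (x : f.GNS) :
    gnsMap (.refl ℂ A) f x = x := by
  induction x using Completion.induction_on with
  | hp => exact isClosed_eq (gnsMap (.refl ℂ A) f).continuous continuous_id
  | ih x => exact gnsMap_coe _ _ x

/-- Iterated pullbacks agree definitionally with the pullback along the composite, so both sides act
on the same space and no identification intervenes. By density it suffices to check classes of
algebra elements. -/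
theorem gnsMap_gnsMap (j : A ≃⋆ₐ[ℂ] B) (k : B ≃⋆ₐ[ℂ] C) (f : C →ₚ[ℂ] ℂ)
    (x : (pullback j (pullback k f)).GNS) :
    gnsMap k f (gnsMap j (pullback k f) x) = gnsMap (j.trans k) f x := by
  induction x using Completion.induction_on with
  | hp =>
    exact isClosed_eq ((gnsMap k f).continuous.comp (gnsMap j (pullback k f)).continuous)
      (gnsMap (j.trans k) f).continuous
  | ih x =>
    rw [gnsMap_coe, gnsMap_coe]
    exact (gnsMap_coe (j.trans k) f x).symm

theorem gnsMap_gns (j : A ≃⋆ₐ[ℂ] B) (f : B →ₚ[ℂ] ℂ) (a : A) (x : (pullback j f).GNS) :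
    gnsMap j f ((pullback j f).gnsNonUnitalStarAlgHom a x) =
      f.gnsNonUnitalStarAlgHom (j a) (gnsMap j f x) := by
  induction x using Completion.induction_on with
  | hp => exact isClosed_eq (by fun_prop) (by fun_prop)
  | ih x =>
    rw [gnsMap_coe, gnsNonUnitalStarAlgHom_apply_coe, gnsMap_coe, gnsNonUnitalStarAlgHom_apply_coe]
    simp

end Pullback

end PositiveLinearMap

open PositiveLinearMap

/-! ### Direct sum over all positive functionals -/

section

variable (A : Type*) [CStarAlgebra A] [PartialOrder A] [StarOrderedRing A]

/-- The Hilbert sum of the GNS spaces of all the positive functionals of a C*-algebra. -/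
noncomputable abbrev UniversalSpace := lp (fun f : A →ₚ[ℂ] ℂ => f.GNS) 2

variable {A}

theorem norm_gns_le (a : A) (f : A →ₚ[ℂ] ℂ) : ‖f.gnsNonUnitalStarAlgHom a‖ ≤ ‖a‖ :=
  NonUnitalStarAlgHom.norm_apply_le _ a

/-- The direct sum of the operators of the GNS representations. -/
noncomputable def universalOp (a : A) : UniversalSpace A →L[ℂ] UniversalSpace A :=
  lp.mapCLM 2 (fun f : A →ₚ[ℂ] ℂ => f.gnsNonUnitalStarAlgHom a) (norm_nonneg a) (norm_gns_le a)

@[simp]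
theorem universalOp_apply (a : A) (x : UniversalSpace A) (f : A →ₚ[ℂ] ℂ) :
    universalOp a x f = f.gnsNonUnitalStarAlgHom a (x f) := rfl

variable (A) in
/-- The direct sum of the GNS representations of all the positive functionals. -/
noncomputable def universalRep : A →⋆ₙₐ[ℂ] (UniversalSpace A →L[ℂ] UniversalSpace A) where
  toFun := universalOp
  map_smul' z a := by ext x f; simp
  map_zero' := by ext x f; simp
  map_add' a b := by ext x f; simp
  map_mul' a b := by ext x f; simp
  map_star' a := by
    rw [ContinuousLinearMap.star_eq_adjoint, ContinuousLinearMap.eq_adjoint_iff]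
    intro x y
    rw [lp.inner_eq_tsum, lp.inner_eq_tsum]
    refine tsum_congr fun f => ?_
    rw [universalOp_apply, universalOp_apply, map_star, ContinuousLinearMap.star_eq_adjoint,
      ContinuousLinearMap.adjoint_inner_left]

theorem universalRep_apply (a : A) (x : UniversalSpace A) (f : A →ₚ[ℂ] ℂ) :
    universalRep A a x f = f.gnsNonUnitalStarAlgHom a (x f) := rfl

theorem universalRep_injective : Function.Injective (universalRep A) := by
  refine (injective_iff_map_eq_zero _).2 fun a ha => by_contra fun h => ?_
  obtain ⟨f, hf⟩ := exists_apply_star_mul_self_ne_zero h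
  refine gnsNonUnitalStarAlgHom_ne_zero hf ?_
  classical
  ext1 x
  -- Testing on vectors supported in the `f`-th summand isolates the GNS representation of `f`.
  have := congrArg (fun y : UniversalSpace A => y f)
    (DFunLike.congr_fun ha (lp.single 2 f x))
  simpa [universalRep_apply] using this

variable {B C : Type*} [CStarAlgebra B] [PartialOrder B] [StarOrderedRing B]
  [CStarAlgebra C] [PartialOrder C] [StarOrderedRing C]

theorem summable_norm_sq (x : UniversalSpace A) : Summable fun f => ‖x f‖ ^ 2 := by
  simpa using (memℓp_gen_iff (p := 2) (by norm_num)).1 (lp.memℓp x)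

theorem universalSpace_norm_sq (x : UniversalSpace A) : ‖x‖ ^ 2 = ∑' f, ‖x f‖ ^ 2 := by
  simpa using lp.norm_rpow_eq_tsum (p := 2) (by norm_num) x

/-- The coordinate at `f` has the norm of the coordinate of `x` at the pullback of `f`, and pullback
is a bijection of index sets: the squared norms are merely reindexed. -/
theorem memℓp_gnsMap (j : A ≃⋆ₐ[ℂ] B) (x : UniversalSpace A) :
    Memℓp (fun f : B →ₚ[ℂ] ℂ => gnsMap j f (x (pullback j f))) 2 := by
  have h : Summable fun f => ‖x (pullback j f)‖ ^ 2 :=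
    (pullbackEquiv j).summable_iff.2 (summable_norm_sq x)
  exact (memℓp_gen_iff (by norm_num)).2 (by simpa [norm_gnsMap] using h)

/-- The isometry between the universal spaces induced by a *-isomorphism. -/
noncomputable def universalIsometry (j : A ≃⋆ₐ[ℂ] B) :
    UniversalSpace A →ₗᵢ[ℂ] UniversalSpace B where
  toFun x := ⟨fun f => gnsMap j f (x (pullback j f)), memℓp_gnsMap j x⟩
  map_add' x y := by ext f; simp; rfl
  map_smul' z x := by ext f; simp
  norm_map' x := by
    refine (sq_eq_sq₀ (norm_nonneg _) (norm_nonneg _)).1 ?_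
    rw [universalSpace_norm_sq, universalSpace_norm_sq, ← (pullbackEquiv j).tsum_eq]
    exact tsum_congr fun f => congrArg (· ^ 2) (norm_gnsMap j f _)

theorem universalIsometry_refl (x : UniversalSpace A) : universalIsometry (.refl ℂ A) x = x := by
  ext f
  exact gnsMap_refl f (x f)

theorem universalIsometry_trans (j : A ≃⋆ₐ[ℂ] B) (k : B ≃⋆ₐ[ℂ] C) (x : UniversalSpace A) :
    universalIsometry k (universalIsometry j x) = universalIsometry (j.trans k) x := by
  ext f
  exact gnsMap_gnsMap j k f _

/-- The unitary between the universal spaces induced by a *-isomorphism. -/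
noncomputable def universalUnitary (j : A ≃⋆ₐ[ℂ] B) :
    UniversalSpace A ≃ₗᵢ[ℂ] UniversalSpace B :=
  .ofSurjective (universalIsometry j) fun y => ⟨universalIsometry j.symm y, by
    have h : j.symm.trans j = .refl ℂ B := by ext b; exact j.apply_symm_apply b
    rw [universalIsometry_trans, h, universalIsometry_refl]⟩

theorem universalUnitary_apply (j : A ≃⋆ₐ[ℂ] B) (x : UniversalSpace A) :
    universalUnitary j x = universalIsometry j x := rfl

theorem universalUnitary_rep (j : A ≃⋆ₐ[ℂ] B) (a : A) (x : UniversalSpace A) :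
    universalUnitary j (universalRep A a x) = universalRep B (j a) (universalUnitary j x) := by
  ext f
  exact gnsMap_gns j f a _

end

end Universal

/-! ### Representing a net through its enveloping bundle -/

namespace CStarNet

variable {K : Type u} [PartialOrder K]

section

-- The fibres carry no order; the spectral order gives meaning to positive functionals on them.
attribute [local instance] CStarAlgebra.spectralOrder CStarAlgebra.spectralOrderedRing

/-- The inclusion maps of a C*-net bundle as *-isomorphisms. -/
noncomputable def inclEquiv {M : CStarNet.{u, w} K} (hM : M.IsBundle) {a o : K} (h : a ≤ o) :
    M.fibre a ≃⋆ₐ[ℂ] M.fibre o :=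
  StarAlgEquiv.ofBijective (M.incl h) (hM h)

/-- The direct sums of the GNS representations of the fibres of a C*-net bundle form a
representation of any net mapping into it. -/
noncomputable def Hom.universalRepresentation {N : CStarNet.{u, v} K} {M : CStarNet.{u, w} K}
    (φ : Hom N M) (hM : M.IsBundle) : Representation.{u, v, w} N where
  space o := UniversalSpace (M.fibre o)
  rep o := (universalRep (M.fibre o)).comp (φ.map o)
  op h := universalUnitary (inclEquiv hM h)
  op_rep {a o} h A x := by
    change universalUnitary (inclEquiv hM h) (universalRep (M.fibre a) (φ.map a A) x) =
      universalRep (M.fibre o) (φ.map o (N.incl h A)) _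
    rw [universalUnitary_rep, φ.map_incl]
    rfl
  op_op h h' x := by
    rw [universalUnitary_apply, universalUnitary_apply, universalUnitary_apply,
      universalIsometry_trans]
    -- The cocycle relation reduces to equality of the underlying *-isomorphisms, which is the net
    -- relation in `M`.
    congr 2
    ext A
    exact M.incl_incl h h' A

theorem Hom.universalRepresentation_rep_eq_zero_iff {N : CStarNet.{u, v} K}
    {M : CStarNet.{u, w} K} (φ : Hom N M) (hM : M.IsBundle) {o : K} (A : N.fibre o) :
    (φ.universalRepresentation hM).rep o A = 0 ↔ φ.map o A = 0 :=
  map_eq_zero_iff (universalRep (M.fibre o)) universalRep_injective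

end

variable {N : CStarNet.{u, v} K}

/-- If the representation killed the unit of a fibre, faithfulness of the universal representation
would give `ε_o(1) = 0`; but `ε` is unital, so `1 = 0` in every fibre of the enveloping bundle. -/
theorem IsNondegenerate.exists_not_vanishes (h : N.IsNondegenerate) :
    ∃ R : Representation.{u, v, max u v} N, ¬ R.Vanishes := by
  refine ⟨N.canonicalEmbedding.universalRepresentation N.enveloping_isBundle, fun hR => h fun o =>
    subsingleton_of_zero_eq_one ?_⟩
  rw [← N.canonicalEmbedding_isUnital o]
  exact ((Hom.universalRepresentation_rep_eq_zero_iff _ _ _).1 (hR o 1)).symm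

theorem IsInjective.exists_isFaithful (h : N.IsInjective) :
    ∃ R : Representation.{u, v, max u v} N, R.IsFaithful := by
  refine ⟨N.canonicalEmbedding.universalRepresentation N.enveloping_isBundle, fun o =>
    (injective_iff_map_eq_zero _).2 fun A hA => ?_⟩
  rw [Hom.universalRepresentation_rep_eq_zero_iff] at hA
  exact (injective_iff_map_eq_zero _).1 (h.2 o) A hA

end CStarNet

theorem mainTheorem3 {K : Type u} [PartialOrder K] (hK : IsPathwiseConnected K)
    (N : CStarNet.{u, v} K) :
    (¬ N.Vanishes →
      (N.IsInjective ↔ ∃ R : CStarNet.Representation.{u, v, max u v} N, R.IsFaithful)) ∧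
    (N.IsNondegenerate ↔ ∃ R : CStarNet.Representation.{u, v, max u v} N, ¬ R.Vanishes) :=
  ⟨fun hN => ⟨fun h => h.exists_isFaithful, fun ⟨R, hR⟩ => R.isInjective hN hR⟩,
    fun h => h.exists_not_vanishes, fun ⟨R, hR⟩ => R.isNondegenerate hR⟩
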